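/- Let $D=\{D(s),\,s\ge 0\}$ be a subordinator, that is, a real-valued Lévy process with $D(0)=0$ whose paths are nondecreasing and right-continuous with left limits, and suppose that $D$ is not almost surely identically zero. Let $$Y(t)=\inf\{s\ge 0 : D(s)>t\},\qquad t\ge 0,$$ be the inverse subordinator, and write $U^{\gamma}(t)=\mathbb{E}[Y(t)^{\gamma}]$ (a moment of order $\gamma$, not a power of $U$) and $U(t)=U^{1}(t)=\mathbb{E}[Y(t)]$. Then $Y$ is almost surely finite, $U$ is finite, nondecreasing and right-continuous on $[0,\infty)$, and for all $s,t>0$ and all real $\kappa>0$, $$\mathbb{E}\left[|Y(t)-Y(s)|^{\kappa}\right]=U^{\kappa}(\max(t,s))-\kappa\int_{[0,\min(t,s)]}U^{\kappa-1}(\max(t,s)-y)\,dU(y),$$ where all the expectations and integrals are finite (those defining $U^{\kappa-1}(\max(t,s)-y)$ for $dU$-almost every $y\in[0,\min(t,s)]$). Here $dU$ is the Lebesgue–Stieltjes measure of $U$ extended by $U(x)=0$ for $x<0$, so that it has an atom of mass $U(0)$ at $0$ if $U(0)>0$. -/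

import Mathlib

open MeasureTheory ProbabilityTheory
open scoped NNReal ENNReal

/-- A (real-valued, never killed) subordinator: a Lévy process whose paths almost surely start
at `0`, are nondecreasing and right-continuous. Left limits exist automatically for nondecreasing
paths, and stochastic continuity follows from right-continuity and stationarity. -/
structure IsSubordinator {Ω : Type*} [MeasurableSpace Ω] (D : ℝ≥0 → Ω → ℝ) (P : Measure Ω) :
    Prop where
  measurable : ∀ s, Measurable (D s)
  start_zero : ∀ᵐ ω ∂P, D 0 ω = 0
  mono : ∀ᵐ ω ∂P, Monotone fun s => D s ω
  right_cont : ∀ᵐ ω ∂P, ∀ s, ContinuousWithinAt (fun r => D r ω) (Set.Ici s) s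
  indep_increments : HasIndepIncrements D P
  stationary_increments : ∀ s h, IdentDistrib (D (s + h) - D s) (D h) P P

/-- The first-passage time `Y(t) = inf {s ≥ 0 : D(s) > t}`, on one outcome. -/
noncomputable def inverseSubordinator {Ω : Type*} (D : ℝ≥0 → Ω → ℝ) (t : ℝ) (ω : Ω) : ℝ :=
  ((sInf {s : ℝ≥0 | t < D s ω} : ℝ≥0) : ℝ)

/-- The moment function `U^γ(t) = E[Y(t)^γ]` of the inverse subordinator. -/
noncomputable def inverseMoment {Ω : Type*} [MeasurableSpace Ω] (D : ℝ≥0 → Ω → ℝ) (P : Measure Ω)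
    (γ t : ℝ) : ℝ :=
  ∫ ω, inverseSubordinator D t ω ^ γ ∂P

/-! ### Tail estimates for `D` at fixed times. -/

namespace IsSubordinator

variable {Ω : Type*} [MeasurableSpace Ω] {P : Measure Ω} {D : ℝ≥0 → Ω → ℝ}

/-! Take s ≤ t. On each path, 0 ≤ Y(s) ≤ Y(t), and integrating a power function gives Y(t)^κ − (Y(t)
− Y(s))^κ = κ ∫_0^{Y(s)} (Y(t) − u)^(κ−1) du. Take expectations and exchange the integrals. For
almost every u the event u < Y(s) is the event D(u) ≤ s, and by the Markov property, given D(u) = y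
≤ s, the remainder Y(t) − u has the law of Y(t − y). The right side becomes κ ∫_{y ≤ s} E[Y(t −
y)^(κ−1)] against the potential measure ∫_0^∞ P(D(u) ∈ dy) du (`lintegral_lintegral_inverse_sub`).
The layer-cake formula identifies the distribution function of that measure as U
(`potentialMeasure_Iic`), so it is dU.

The exchange is done for `ℝ≥0∞`-valued integrals and needs no integrability beforehand, even when κ
< 1 makes the exponent negative. Finiteness is read off afterwards from E[Y(t)^κ] < ∞, which follows
from the geometric tail P(Y(t) > nh) ≤ P(D(h) ≤ t)^n for some h with P(D(h) ≤ t) < 1. -/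

lemma indepFun_increment (hD : IsSubordinator D P) (u r : ℝ≥0) :
    IndepFun (D u) (D (u + r) - D u) P :=
  hD.indep_increments.indepFun_eval_sub zero_le le_self_add hD.start_zero

lemma ae_nonneg (hD : IsSubordinator D P) : ∀ᵐ ω ∂P, ∀ u, 0 ≤ D u ω := by
  filter_upwards [hD.start_zero, hD.mono] with ω h0 hm u
  rw [← h0]
  exact hm zero_le

lemma map_eval_increment [IsProbabilityMeasure P] (hD : IsSubordinator D P) (u r : ℝ≥0) :
    P.map (fun ω => (D u ω, (D (u + r) - D u) ω)) = (P.map (D u)).prod (P.map (D r)) := by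
  have h := (indepFun_iff_map_prod_eq_prod_map_map (hD.measurable u).aemeasurable
    ((hD.measurable (u + r)).sub (hD.measurable u)).aemeasurable).1 (hD.indepFun_increment u r)
  rw [h, (hD.stationary_increments u r).map_eq]

/-- The Markov property at a fixed time, for two-dimensional marginals. -/
lemma measure_le_and_le [IsProbabilityMeasure P] (hD : IsSubordinator D P) (u r : ℝ≥0)
    (s t : ℝ) :
    P {ω | D u ω ≤ s ∧ D (u + r) ω ≤ t} =
      ∫⁻ y in Set.Iic s, P {ω | D r ω ≤ t - y} ∂(P.map (D u)) := by
  have hS : MeasurableSet {p : ℝ × ℝ | p.1 ≤ s ∧ p.1 + p.2 ≤ t} :=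
    (measurableSet_le measurable_fst measurable_const).inter
      (measurableSet_le (measurable_fst.add measurable_snd) measurable_const)
  have := hD.measurable u
  have := hD.measurable (u + r)
  have h1 : P {ω | D u ω ≤ s ∧ D (u + r) ω ≤ t} =
      P.map (fun ω => (D u ω, (D (u + r) - D u) ω)) {p : ℝ × ℝ | p.1 ≤ s ∧ p.1 + p.2 ≤ t} := by
    rw [Measure.map_apply (by fun_prop) hS]
    congr 1
    ext ω
    simp
  rw [h1, hD.map_eval_increment, Measure.prod_apply hS, ← lintegral_indicator measurableSet_Iic]
  refine lintegral_congr fun y => ?_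
  by_cases hy : y ≤ s
  · rw [Set.indicator_of_mem (by simpa using hy), Measure.map_apply (hD.measurable r) (by measurability)]
    congr 1
    ext ω
    simp [hy, le_sub_iff_add_le']
  · rw [Set.indicator_of_notMem (by simpa using hy)]
    simp [hy]

/-- Given D(u) = y with 0 ≤ y ≤ t, the increment over r must stay below t − y ≤ t. This
submultiplicativity is the source of the geometric tails of Y. -/
lemma measure_add_le [IsProbabilityMeasure P] (hD : IsSubordinator D P) (u r : ℝ≥0) (t : ℝ) :
    P {ω | D (u + r) ω ≤ t} ≤ P {ω | D u ω ≤ t} * P {ω | D r ω ≤ t} := by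
  have h1 : P {ω | D (u + r) ω ≤ t} ≤ P {ω | D u ω ≤ t ∧ D (u + r) ω ≤ t} := by
    refine measure_mono_ae ?_
    filter_upwards [hD.mono] with ω hm h
    exact ⟨(hm le_self_add).trans h, h⟩
  refine h1.trans ?_
  rw [hD.measure_le_and_le]
  have h2 : ∀ᵐ y ∂(P.map (D u)).restrict (Set.Iic t),
      P {ω | D r ω ≤ t - y} ≤ P {ω | D r ω ≤ t} := by
    refine ae_restrict_of_ae ?_
    have : ∀ᵐ y ∂(P.map (D u)), 0 ≤ y := by
      rw [ae_map_iff (hD.measurable u).aemeasurable measurableSet_Ici]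
      filter_upwards [hD.ae_nonneg] with ω h using h u
    filter_upwards [this] with y hy
    refine measure_mono fun ω (h : D r ω ≤ t - y) => ?_
    exact h.trans (by linarith)
  refine (lintegral_mono_ae h2).trans ?_
  rw [lintegral_const, Measure.restrict_apply_univ,
    Measure.map_apply (hD.measurable u) measurableSet_Iic, mul_comm]
  rfl

lemma measure_nsmul_le [IsProbabilityMeasure P] (hD : IsSubordinator D P) (h : ℝ≥0) (t : ℝ)
    (n : ℕ) : P {ω | D (n * h) ω ≤ t} ≤ P {ω | D h ω ≤ t} ^ n := by
  induction n with
  | zero => simpa using prob_le_one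
  | succ n ih =>
    rw [Nat.cast_succ, add_mul, one_mul, pow_succ]
    exact (hD.measure_add_le _ _ _).trans (mul_le_mul_left ih _)

lemma measure_gt_mul_measure_gt_le [IsProbabilityMeasure P] (hD : IsSubordinator D P)
    (u r : ℝ≥0) (a b : ℝ) :
    P {ω | a < D u ω} * P {ω | b < D r ω} ≤ P {ω | a + b < D (u + r) ω} := by
  have h1 : P {ω | a < D u ω} * P {ω | b < D r ω} =
      P.map (fun ω => (D u ω, (D (u + r) - D u) ω)) (Set.Ioi a ×ˢ Set.Ioi b) := by
    rw [hD.map_eval_increment, Measure.prod_prod,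
      Measure.map_apply (hD.measurable u) measurableSet_Ioi,
      Measure.map_apply (hD.measurable r) measurableSet_Ioi]
    rfl
  have := hD.measurable u
  have := hD.measurable (u + r)
  rw [h1, Measure.map_apply (by fun_prop) (measurableSet_Ioi.prod measurableSet_Ioi)]
  refine measure_mono fun ω h => ?_
  simp only [Set.mem_preimage, Set.mem_prod, Set.mem_Ioi, Pi.sub_apply] at h
  simp only [Set.mem_ofPred_eq]
  linarith [h.1, h.2]

/-- Independent increments can all exceed a at once, so a small level passed with positive
probability yields arbitrarily high ones. -/
lemma measure_nsmul_gt_pos [IsProbabilityMeasure P] (hD : IsSubordinator D P) {r : ℝ≥0} {a : ℝ}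
    (h : 0 < P {ω | a < D r ω}) (n : ℕ) :
    0 < P {ω | ((n + 1 : ℕ) : ℝ) * a < D ((n + 1 : ℕ) * r) ω} := by
  induction n with
  | zero => simpa using h
  | succ n ih =>
    have := hD.measure_gt_mul_measure_gt_le ((n + 1 : ℕ) * r) r ((n + 1 : ℕ) * a) a
    refine (ENNReal.mul_pos ih.ne' h.ne').trans_le (this.trans_eq ?_)
    rw [Nat.cast_succ (n + 1), Nat.cast_succ (n + 1), add_mul, add_mul, one_mul, one_mul]

/-- A nonzero subordinator exceeds any level with positive probability, at a suitable time. -/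
lemma exists_measure_le_lt_one [IsProbabilityMeasure P] (hD : IsSubordinator D P)
    (hD0 : ∃ s, ¬ (∀ᵐ ω ∂P, D s ω = 0)) (t : ℝ) :
    ∃ h : ℝ≥0, 0 < h ∧ P {ω | D h ω ≤ t} < 1 := by
  obtain ⟨r, hr⟩ := hD0
  have h1 : ∃ n : ℕ, 0 < P {ω | 1 / ((n : ℝ) + 1) < D r ω} := by
    by_contra! hc
    refine hr ?_
    have h2 : ∀ n : ℕ, ∀ᵐ ω ∂P, D r ω ≤ 1 / ((n : ℝ) + 1) := by
      intro n
      rw [ae_iff]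
      simpa using hc n
    filter_upwards [ae_all_iff.2 h2, hD.ae_nonneg] with ω h3 h4
    refine le_antisymm (le_of_forall_pos_le_add fun ε hε => ?_) (h4 r)
    obtain ⟨n, hn⟩ := exists_nat_one_div_lt hε
    linarith [h3 n]
  obtain ⟨n, hn⟩ := h1
  obtain ⟨m, hm⟩ := exists_nat_ge (t * ((n : ℝ) + 1))
  have h2 := hD.measure_nsmul_gt_pos hn m
  have hn0 : (0 : ℝ) < n + 1 := by positivity
  have h3 : 0 < P {ω | t < D ((m + 1 : ℕ) * r) ω} := by
    refine h2.trans_le (measure_mono fun ω h => ?_)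
    rw [Set.mem_ofPred_eq] at h ⊢
    refine lt_of_le_of_lt ?_ h
    rw [mul_one_div, le_div_iff₀ hn0]
    push_cast
    linarith
  have h4 : P {ω | D ((m + 1 : ℕ) * r) ω ≤ t} < 1 := by
    have h5 : {ω | D ((m + 1 : ℕ) * r) ω ≤ t} = {ω | t < D ((m + 1 : ℕ) * r) ω}ᶜ := by
      ext ω; simp
    rw [h5, prob_compl_eq_one_sub (measurableSet_lt measurable_const (hD.measurable _))]
    exact ENNReal.sub_lt_self (by simp) (by simp) h3.ne'
  -- Adding 1 makes the time visibly positive; by monotone paths the probability can only drop.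
  refine ⟨(m + 1 : ℕ) * r + 1, by positivity, lt_of_le_of_lt (measure_mono_ae ?_) h4⟩
  filter_upwards [hD.mono] with ω hmono h
  exact (hmono le_self_add).trans h

lemma ae_unbounded [IsProbabilityMeasure P] (hD : IsSubordinator D P)
    (hD0 : ∃ s, ¬ (∀ᵐ ω ∂P, D s ω = 0)) : ∀ᵐ ω ∂P, ∀ x : ℝ, ∃ s, x < D s ω := by
  have h1 : ∀ k : ℕ, ∀ᵐ ω ∂P, ∃ s, (k : ℝ) < D s ω := by
    intro k
    obtain ⟨h, -, hlt⟩ := hD.exists_measure_le_lt_one hD0 k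
    rw [ae_iff]
    refine le_antisymm (ge_of_tendsto' (ENNReal.tendsto_pow_atTop_nhds_zero_of_lt_one hlt)
      fun n => (measure_mono fun ω hω => ?_).trans (hD.measure_nsmul_le h k n)) zero_le
    simp only [Set.mem_ofPred_eq, not_exists, not_lt] at hω ⊢
    exact hω _
  filter_upwards [ae_all_iff.2 h1] with ω hω x
  obtain ⟨k, hk⟩ := exists_nat_ge x
  obtain ⟨s, hs⟩ := hω k
  exact ⟨s, hk.trans_lt hs⟩

end IsSubordinator

/-! ### Pathwise relations between `D` and its inverse. -/

section Pathwise

variable {Ω : Type*} {D : ℝ≥0 → Ω → ℝ} {z : ℝ} {ω : Ω}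

lemma inverseSubordinator_nonneg : 0 ≤ inverseSubordinator D z ω := NNReal.coe_nonneg _

lemma le_of_lt_inverseSubordinator {u : ℝ≥0} (h : (u : ℝ) < inverseSubordinator D z ω) :
    D u ω ≤ z := by
  by_contra! hc
  exact absurd (NNReal.coe_lt_coe.1 h) (not_lt.2 (csInf_le (OrderBot.bddBelow _) hc))

lemma le_inverseSubordinator (hm : Monotone fun s => D s ω) (hunb : ∃ s, z < D s ω) {u : ℝ≥0}
    (h : D u ω ≤ z) : (u : ℝ) ≤ inverseSubordinator D z ω := by
  refine NNReal.coe_le_coe.2 (le_csInf hunb fun r (hr : z < D r ω) => ?_)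
  by_contra! hc
  exact absurd ((hm hc.le).trans h) (not_le.2 hr)

/-- D(u) ≤ z alone gives only u ≤ Y(z); the strict inequality needs a later time still at or below
z. Restricting to the times u + 1/(n+1) makes the event a countable union, whence measurability of Y
and continuity from below. -/
lemma lt_inverseSubordinator_iff (hm : Monotone fun s => D s ω) (hunb : ∃ s, z < D s ω)
    {u : ℝ≥0} :
    (u : ℝ) < inverseSubordinator D z ω ↔ ∃ n : ℕ, D (u + 1 / ((n : ℝ≥0) + 1)) ω ≤ z := by
  constructor
  · intro h
    obtain ⟨n, hn⟩ := exists_nat_one_div_lt (sub_pos.2 h)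
    refine ⟨n, le_of_lt_inverseSubordinator ?_⟩
    push_cast
    linarith
  · rintro ⟨n, hn⟩
    refine lt_of_lt_of_le ?_ (le_inverseSubordinator hm hunb hn)
    push_cast
    have : (0 : ℝ) < 1 / ((n : ℝ) + 1) := by positivity
    linarith

lemma inverseSubordinator_mono (hunb : ∀ x, ∃ s, x < D s ω) :
    Monotone fun z => inverseSubordinator D z ω := fun _ y hxy =>
  NNReal.coe_le_coe.2 (csInf_le_csInf (OrderBot.bddBelow _) (hunb y)
    fun _ h => lt_of_le_of_lt hxy h)

end Pathwise

/-! ### Moments of the inverse. -/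

lemma summable_rpow_mul_geometric {κ : ℝ} (c : ℝ) (hc : 0 ≤ c) {p : ℝ} (hp : 0 ≤ p)
    (hp1 : p < 1) : Summable fun n : ℕ => (((n : ℝ) + 1) * c) ^ κ * p ^ n := by
  -- p may be 0; a positive ratio q can be divided out when the index is shifted from n + 1 to n.
  obtain ⟨q, hpq, hq1⟩ := exists_between hp1
  have hq : 0 < q := hp.trans_lt hpq
  obtain ⟨k, hk⟩ := exists_nat_ge κ
  have h1 : Summable fun n : ℕ => (n : ℝ) ^ k * q ^ n :=
    summable_pow_mul_geometric_of_norm_lt_one k (by rwa [Real.norm_of_nonneg hq.le])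
  have h2 := (((summable_nat_add_iff 1).2 h1).mul_left q⁻¹).mul_left (c ^ κ)
  refine Summable.of_nonneg_of_le (fun n => by positivity) (fun n => ?_) h2
  have h3 : ((n : ℝ) + 1) ^ κ ≤ ((n : ℝ) + 1) ^ k := by
    rw [← Real.rpow_natCast]
    exact Real.rpow_le_rpow_of_exponent_le (by linarith [(Nat.cast_nonneg n : (0 : ℝ) ≤ n)]) hk
  have h4 : p ^ n ≤ q ^ n := pow_le_pow_left₀ hp hpq.le n
  have h5 : c ^ κ * (q⁻¹ * (((n + 1 : ℕ) : ℝ) ^ k * q ^ (n + 1))) =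
      c ^ κ * (((n : ℝ) + 1) ^ k * q ^ n) := by
    push_cast
    field_simp
    ring
  rw [h5, Real.mul_rpow (by positivity) hc, mul_comm (_ ^ κ) (c ^ κ), mul_assoc]
  gcongr

/-- A nonnegative random variable with geometrically decaying tails has moments of all orders. -/
lemma lintegral_rpow_lt_top_of_tail_le_pow {Ω : Type*} [MeasurableSpace Ω] {P : Measure Ω}
    {X : Ω → ℝ} (hX : AEMeasurable X P) (hX0 : ∀ ω, 0 ≤ X ω) {h : ℝ} (hh : 0 < h) {p : ℝ≥0∞}
    (hp : p < 1) (htail : ∀ n : ℕ, P {ω | n * h < X ω} ≤ p ^ n) {κ : ℝ} (hκ : 0 < κ) :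
    ∫⁻ ω, ENNReal.ofReal (X ω ^ κ) ∂P < ∞ := by
  have hb : ∀ ω, ENNReal.ofReal (X ω ^ κ) ≤ ∑' n : ℕ,
      {ω | n * h < X ω}.indicator (fun _ => ENNReal.ofReal ((((n : ℝ) + 1) * h) ^ κ)) ω := by
    intro ω
    rcases (hX0 ω).eq_or_lt with h0 | h0
    · rw [← h0, Real.zero_rpow hκ.ne', ENNReal.ofReal_zero]
      exact zero_le
    -- The single term with nh < X ≤ (n+1)h already dominates X^κ.
    have hc : 0 < ⌈X ω / h⌉₊ := Nat.ceil_pos.2 (by positivity)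
    obtain ⟨n, hn⟩ : ∃ n, ⌈X ω / h⌉₊ = n + 1 := Nat.exists_eq_add_one.2 hc
    have h1 : (n : ℝ) * h < X ω := by
      rw [← lt_div_iff₀ hh]
      exact Nat.lt_ceil.1 (by omega)
    have h2 : X ω ≤ ((n : ℝ) + 1) * h := by
      rw [← div_le_iff₀ hh]
      have := Nat.le_ceil (X ω / h)
      rw [hn] at this
      exact_mod_cast this
    refine le_trans ?_ (ENNReal.le_tsum n)
    rw [Set.indicator_of_mem (by simpa using h1)]
    exact ENNReal.ofReal_le_ofReal (Real.rpow_le_rpow h0.le h2 hκ.le)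
  have hms : ∀ n : ℕ, NullMeasurableSet {ω | n * h < X ω} P := fun n =>
    nullMeasurableSet_lt aemeasurable_const hX
  have hpr : p = ENNReal.ofReal p.toReal := (ENNReal.ofReal_toReal (hp.trans (by simp)).ne).symm
  calc ∫⁻ ω, ENNReal.ofReal (X ω ^ κ) ∂P
      ≤ ∫⁻ ω, ∑' n : ℕ,
      {ω | n * h < X ω}.indicator (fun _ => ENNReal.ofReal ((((n : ℝ) + 1) * h) ^ κ)) ω ∂P :=
        lintegral_mono hb
    _ = ∑' n : ℕ, ENNReal.ofReal ((((n : ℝ) + 1) * h) ^ κ) * P {ω | n * h < X ω} := by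
        rw [lintegral_tsum fun n => aemeasurable_const.indicator₀ (hms n)]
        congr with n
        rw [lintegral_indicator_const₀ (hms n)]
    _ ≤ ∑' n : ℕ, ENNReal.ofReal ((((n : ℝ) + 1) * h) ^ κ * p.toReal ^ n) := by
        refine ENNReal.tsum_le_tsum fun n => ?_
        rw [ENNReal.ofReal_mul (by positivity), ENNReal.ofReal_pow (by positivity), ← hpr]
        gcongr
        exact htail n
    _ < ∞ := by
        have hs := summable_rpow_mul_geometric h hh.le (κ := κ) (p := p.toReal) (by positivity)
          (by simpa using (ENNReal.toReal_lt_toReal (hp.trans (by simp)).ne (by simp)).2 hp)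
        exact hs.tsum_ofReal_lt_top

namespace IsSubordinator

variable {Ω : Type*} [MeasurableSpace Ω] {P : Measure Ω} [IsProbabilityMeasure P]
  {D : ℝ≥0 → Ω → ℝ}

lemma aemeasurable_inverse (hD : IsSubordinator D P) (hD0 : ∃ s, ¬ (∀ᵐ ω ∂P, D s ω = 0))
    (z : ℝ) : AEMeasurable (inverseSubordinator D z) P := by
  refine NullMeasurable.aemeasurable ?_
  refine measurable_of_Ioi (δ := NullMeasurableSpace Ω P) fun r => ?_
  change NullMeasurableSet (inverseSubordinator D z ⁻¹' Set.Ioi r) P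
  rcases lt_or_ge r 0 with hr | hr
  · convert MeasurableSet.univ.nullMeasurableSet
    ext ω
    simpa using hr.trans_le inverseSubordinator_nonneg
  lift r to ℝ≥0 using hr
  have h1 : MeasurableSet (⋃ n : ℕ, {ω | D (r + 1 / ((n : ℝ≥0) + 1)) ω ≤ z}) :=
    MeasurableSet.iUnion fun n => measurableSet_le (hD.measurable _) measurable_const
  refine h1.nullMeasurableSet.congr ?_
  filter_upwards [hD.mono, hD.ae_unbounded hD0] with ω hm hunb
  refine propext ?_
  change ω ∈ (⋃ n : ℕ, {ω | D (r + 1 / ((n : ℝ≥0) + 1)) ω ≤ z}) ↔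
    (r : ℝ) < inverseSubordinator D z ω
  rw [lt_inverseSubordinator_iff hm (hunb z)]
  simp

lemma lintegral_inverse_rpow_lt_top (hD : IsSubordinator D P)
    (hD0 : ∃ s, ¬ (∀ᵐ ω ∂P, D s ω = 0)) (z : ℝ) {κ : ℝ} (hκ : 0 < κ) :
    ∫⁻ ω, ENNReal.ofReal (inverseSubordinator D z ω ^ κ) ∂P < ∞ := by
  obtain ⟨h, hh, hlt⟩ := hD.exists_measure_le_lt_one hD0 z
  refine lintegral_rpow_lt_top_of_tail_le_pow (hD.aemeasurable_inverse hD0 z)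
    (fun _ => inverseSubordinator_nonneg) (NNReal.coe_pos.2 hh) hlt (fun n => ?_) hκ
  refine (measure_mono fun ω hω => ?_).trans (hD.measure_nsmul_le h z n)
  exact le_of_lt_inverseSubordinator (by simpa using hω)

lemma integrable_inverse_rpow (hD : IsSubordinator D P)
    (hD0 : ∃ s, ¬ (∀ᵐ ω ∂P, D s ω = 0)) (z : ℝ) {κ : ℝ} (hκ : 0 < κ) :
    Integrable (fun ω => inverseSubordinator D z ω ^ κ) P := by
  refine ⟨((hD.aemeasurable_inverse hD0 z).pow_const κ).aestronglyMeasurable, ?_⟩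
  rw [hasFiniteIntegral_iff_ofReal
    (.of_forall fun _ => Real.rpow_nonneg inverseSubordinator_nonneg _)]
  exact hD.lintegral_inverse_rpow_lt_top hD0 z hκ

lemma integrable_inverse (hD : IsSubordinator D P)
    (hD0 : ∃ s, ¬ (∀ᵐ ω ∂P, D s ω = 0)) (z : ℝ) :
    Integrable (inverseSubordinator D z) P := by
  simpa using hD.integrable_inverse_rpow hD0 z one_pos

end IsSubordinator

/-! ### The potential measure and its distribution function. -/

/-- The potential measure `A ↦ ∫₀^∞ P(D(u) ∈ A) du` of a process `D`. -/
noncomputable def potentialMeasure {Ω : Type*} [MeasurableSpace Ω] (D : ℝ≥0 → Ω → ℝ)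
    (P : Measure Ω) : Measure ℝ :=
  (volume.restrict (Set.Ioi (0 : ℝ))).bind fun u => P.map (D u.toNNReal)

namespace IsSubordinator

variable {Ω : Type*} [MeasurableSpace Ω] {P : Measure Ω} [IsProbabilityMeasure P]
  {D : ℝ≥0 → Ω → ℝ}

/-- Monotone paths make u ↦ P(D(u) ≤ x) antitone, hence measurable, and half-lines determine the
law; joint measurability of `D` is not needed. -/
lemma measurable_map_eval (hD : IsSubordinator D P) :
    Measurable fun u : ℝ => P.map (D u.toNNReal) := by
  have : ∀ u : ℝ, IsProbabilityMeasure (P.map (D u.toNNReal)) := fun u =>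
    Measure.isProbabilityMeasure_map (hD.measurable _).aemeasurable
  refine .measure_of_isPiSystem_of_isProbabilityMeasure (borel_eq_generateFrom_Iic ℝ)
    isPiSystem_Iic ?_
  rintro _ ⟨x, rfl⟩
  refine Antitone.measurable fun u v huv => ?_
  simp only [Measure.map_apply (hD.measurable _) measurableSet_Iic]
  refine measure_mono_ae ?_
  filter_upwards [hD.mono] with ω hm h
  exact (hm (Real.toNNReal_le_toNNReal huv)).trans h

lemma measurable_map_inverse (hD : IsSubordinator D P) (hD0 : ∃ s, ¬ (∀ᵐ ω ∂P, D s ω = 0))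
    (t : ℝ) : Measurable fun y : ℝ => P.map (inverseSubordinator D (t - y)) := by
  have : ∀ y : ℝ, IsProbabilityMeasure (P.map (inverseSubordinator D (t - y))) := fun y =>
    Measure.isProbabilityMeasure_map (hD.aemeasurable_inverse hD0 _)
  refine .measure_of_isPiSystem_of_isProbabilityMeasure (borel_eq_generateFrom_Ioi ℝ)
    isPiSystem_Ioi ?_
  rintro _ ⟨x, rfl⟩
  refine Antitone.measurable fun u v huv => ?_
  simp only [Measure.map_apply_of_aemeasurable (hD.aemeasurable_inverse hD0 _) measurableSet_Ioi]
  refine measure_mono_ae ?_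
  filter_upwards [hD.ae_unbounded hD0] with ω hunb h
  exact lt_of_lt_of_le h (inverseSubordinator_mono hunb (by linarith))

/-- The law of Y(z) has at most countably many atoms. -/
lemma ae_measure_inverse_eq_zero (hD : IsSubordinator D P)
    (hD0 : ∃ s, ¬ (∀ᵐ ω ∂P, D s ω = 0)) (z : ℝ) :
    ∀ᵐ u : ℝ, P {ω | inverseSubordinator D z ω = u} = 0 := by
  have h := Measure.countable_meas_level_set_pos₀ (μ := P)
    (hD.aemeasurable_inverse hD0 z).nullMeasurable
  have h' := h.measure_zero volume
  rw [ae_iff]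
  simpa [pos_iff_ne_zero] using h'

/-- Off the atoms of `Y(z)`, the events `D(u) ≤ z` and `u < Y(z)` agree. -/
lemma setOf_le_ae_eq (hD : IsSubordinator D P) (hD0 : ∃ s, ¬ (∀ᵐ ω ∂P, D s ω = 0))
    {z u : ℝ} (hu : 0 ≤ u) (h : P {ω | inverseSubordinator D z ω = u} = 0) :
    ({ω | D u.toNNReal ω ≤ z} : Set Ω) =ᵐ[P] {ω | u < inverseSubordinator D z ω} := by
  lift u to ℝ≥0 using hu
  have h' : ∀ᵐ ω ∂P, inverseSubordinator D z ω ≠ u := by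
    rw [ae_iff]
    simpa using h
  filter_upwards [h', hD.mono, hD.ae_unbounded hD0] with ω hne hm hunb
  refine propext ?_
  change D (u : ℝ).toNNReal ω ≤ z ↔ (u : ℝ) < inverseSubordinator D z ω
  rw [Real.toNNReal_coe]
  exact ⟨fun h => lt_of_le_of_ne (le_inverseSubordinator hm (hunb z) h) hne.symm,
    le_of_lt_inverseSubordinator⟩

/-- Layer cake: E[Y(x)] = ∫_0^∞ P(Y(x) > u) du, and P(Y(x) > u) = P(D(u) ≤ x) for almost every u. -/
lemma potentialMeasure_Iic (hD : IsSubordinator D P) (hD0 : ∃ s, ¬ (∀ᵐ ω ∂P, D s ω = 0))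
    (x : ℝ) :
    potentialMeasure D P (Set.Iic x) = ENNReal.ofReal (∫ ω, inverseSubordinator D x ω ∂P) := by
  rw [potentialMeasure, Measure.bind_apply measurableSet_Iic hD.measurable_map_eval.aemeasurable,
    ofReal_integral_eq_lintegral_ofReal (hD.integrable_inverse hD0 x)
      (.of_forall fun _ => inverseSubordinator_nonneg),
    lintegral_eq_lintegral_meas_lt P (.of_forall fun _ => inverseSubordinator_nonneg)
      (hD.aemeasurable_inverse hD0 x)]
  refine lintegral_congr_ae ?_
  filter_upwards [ae_restrict_of_ae (hD.ae_measure_inverse_eq_zero hD0 x),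
    ae_restrict_mem measurableSet_Ioi] with u hu hu0
  rw [Measure.map_apply (hD.measurable _) measurableSet_Iic]
  exact measure_congr (hD.setOf_le_ae_eq hD0 (le_of_lt hu0) hu)

lemma potentialMeasure_Iio_zero (hD : IsSubordinator D P) :
    potentialMeasure D P (Set.Iio 0) = 0 := by
  rw [potentialMeasure, Measure.bind_apply measurableSet_Iio hD.measurable_map_eval.aemeasurable]
  refine (lintegral_congr fun u => ?_).trans lintegral_zero
  rw [Measure.map_apply (hD.measurable _) measurableSet_Iio]
  have := hD.ae_nonneg
  rw [measure_eq_zero_iff_ae_notMem]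
  filter_upwards [this] with ω h
  simpa using h _

/-! ### The Markov property of the inverse and the occupation formula. -/

/-- The Markov property at time `u` for the first-passage time: on `D(u) ≤ s`, the remaining time
`Y(t) - u` is distributed as the passage time over the remaining level. -/
lemma map_restrict_inverse_sub (hD : IsSubordinator D P)
    (hD0 : ∃ s, ¬ (∀ᵐ ω ∂P, D s ω = 0)) (u : ℝ≥0) {s t : ℝ} (hst : s ≤ t) :
    (P.restrict {ω | D u ω ≤ s}).map (fun ω => inverseSubordinator D t ω - u) =
      ((P.map (D u)).restrict (Set.Iic s)).bind fun y => P.map (inverseSubordinator D (t - y)) := by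
  have hK := hD.measurable_map_inverse hD0 t
  have hY := hD.aemeasurable_inverse hD0
  have hYu : AEMeasurable (fun ω => inverseSubordinator D t ω - u)
      (P.restrict {ω | D u ω ≤ s}) := ((hY t).sub_const _).restrict
  have hms : MeasurableSet {ω | D u ω ≤ s} := measurableSet_le (hD.measurable u) measurable_const
  have : ∀ y : ℝ, IsProbabilityMeasure (P.map (inverseSubordinator D (t - y))) := fun y =>
    Measure.isProbabilityMeasure_map (hY _)
  have huniv : (P.restrict {ω | D u ω ≤ s}).map (fun ω => inverseSubordinator D t ω - u) Set.univ =
      (((P.map (D u)).restrict (Set.Iic s)).bind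
        fun y => P.map (inverseSubordinator D (t - y))) Set.univ := by
    rw [Measure.bind_apply .univ hK.aemeasurable,
      Measure.map_apply_of_aemeasurable hYu .univ]
    simp [Measure.map_apply (hD.measurable u) measurableSet_Iic]
    rfl
  refine ext_of_generate_finite _ (borel_eq_generateFrom_Ioi ℝ) isPiSystem_Ioi ?_ huniv
  rintro _ ⟨r, rfl⟩
  rw [Measure.bind_apply measurableSet_Ioi hK.aemeasurable,
    Measure.map_apply_of_aemeasurable hYu measurableSet_Ioi]
  simp_rw [Measure.map_apply_of_aemeasurable (hY _) measurableSet_Ioi]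
  rcases lt_or_ge r 0 with hr | hr
  · have h1 : ∀ y, P (inverseSubordinator D (t - y) ⁻¹' Set.Ioi r) = 1 := by
      intro y
      rw [← measure_univ (μ := P)]
      congr 1
      ext ω
      simpa using hr.trans_le inverseSubordinator_nonneg
    simp_rw [h1]
    rw [lintegral_one, Measure.restrict_apply_univ,
      Measure.map_apply (hD.measurable u) measurableSet_Iic, Measure.restrict_apply' hms]
    refine measure_congr ?_
    filter_upwards [hD.mono, hD.ae_unbounded hD0] with ω hm hunb
    refine propext ⟨fun h => h.2, fun (h : D u ω ≤ s) => ⟨?_, h⟩⟩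
    change r < inverseSubordinator D t ω - u
    linarith [le_inverseSubordinator hm (hunb t) (h.trans hst)]
  lift r to ℝ≥0 using hr
  -- Times decreasing strictly to r: both tails become suprema of two-dimensional marginals of `D`,
  -- matched for each n by `measure_le_and_le`.
  let a : ℕ → ℝ≥0 := fun n => r + 1 / ((n : ℝ≥0) + 1)
  have ha : Antitone a := fun m n hmn => by
    refine add_le_add le_rfl ?_
    gcongr
  have hint : ∀ y, P (inverseSubordinator D (t - y) ⁻¹' Set.Ioi (r : ℝ)) =
      ⨆ n, P {ω | D (a n) ω ≤ t - y} := by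
    intro y
    -- Intersecting with the almost sure event of monotone paths makes the sets increase for every
    -- ω, as continuity from below requires.
    have hmono : Monotone fun n => {ω | (∀ i j : ℝ≥0, i ≤ j → D i ω ≤ D j ω) ∧
        D (a n) ω ≤ t - y} := fun m n hmn ω h =>
      ⟨h.1, (h.1 _ _ (ha hmn)).trans h.2⟩
    have h2 : ∀ n, P {ω | D (a n) ω ≤ t - y} = P {ω | (∀ i j : ℝ≥0, i ≤ j → D i ω ≤ D j ω) ∧
        D (a n) ω ≤ t - y} := fun n => measure_congr <| by
      filter_upwards [hD.mono] with ω hm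
      exact propext ⟨fun h => ⟨fun i j hij => hm hij, h⟩, fun h => h.2⟩
    simp_rw [h2]
    rw [← hmono.measure_iUnion]
    refine measure_congr ?_
    filter_upwards [hD.mono, hD.ae_unbounded hD0] with ω hm hunb
    refine propext (Iff.trans (lt_inverseSubordinator_iff hm (hunb _)) ?_)
    change _ ↔ ω ∈ ⋃ n, {ω | (∀ i j : ℝ≥0, i ≤ j → D i ω ≤ D j ω) ∧ D (a n) ω ≤ t - y}
    rw [Set.mem_iUnion]
    exact exists_congr fun n => ⟨fun h => ⟨fun i j hij => hm hij, h⟩, fun h => h.2⟩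
  have hext : (P.restrict {ω | D u ω ≤ s})
      ((fun ω => inverseSubordinator D t ω - u) ⁻¹' Set.Ioi (r : ℝ)) =
      ⨆ n, P {ω | D u ω ≤ s ∧ D (u + a n) ω ≤ t} := by
    have hmono : Monotone fun n => {ω | (∀ i j : ℝ≥0, i ≤ j → D i ω ≤ D j ω) ∧
        D u ω ≤ s ∧ D (u + a n) ω ≤ t} := fun m n hmn ω h =>
      ⟨h.1, h.2.1, (h.1 _ _ (add_le_add le_rfl (ha hmn))).trans h.2.2⟩
    have h2 : ∀ n, P {ω | D u ω ≤ s ∧ D (u + a n) ω ≤ t} =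
        P {ω | (∀ i j : ℝ≥0, i ≤ j → D i ω ≤ D j ω) ∧ D u ω ≤ s ∧ D (u + a n) ω ≤ t} :=
      fun n => measure_congr <| by
        filter_upwards [hD.mono] with ω hm
        exact propext ⟨fun h => ⟨fun i j hij => hm hij, h⟩, fun h => h.2⟩
    simp_rw [h2]
    rw [← hmono.measure_iUnion, Measure.restrict_apply' hms]
    refine measure_congr ?_
    filter_upwards [hD.mono, hD.ae_unbounded hD0] with ω hm hunb
    refine propext ?_
    change ((r : ℝ) < inverseSubordinator D t ω - u ∧ D u ω ≤ s) ↔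
      ω ∈ ⋃ n, {ω | (∀ i j : ℝ≥0, i ≤ j → D i ω ≤ D j ω) ∧ D u ω ≤ s ∧ D (u + a n) ω ≤ t}
    rw [Set.mem_iUnion, lt_sub_iff_add_lt', ← NNReal.coe_add,
      lt_inverseSubordinator_iff hm (hunb _)]
    simp only [add_assoc]
    exact ⟨fun ⟨⟨n, h⟩, hs⟩ => ⟨n, fun i j hij => hm hij, hs, h⟩,
      fun ⟨n, _, hs, h⟩ => ⟨⟨n, h⟩, hs⟩⟩
  simp_rw [hext, hint, hD.measure_le_and_le]
  rw [lintegral_iSup]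
  · intro n
    refine Antitone.measurable fun x y hxy => measure_mono fun ω h => ?_
    rw [Set.mem_ofPred_eq] at h ⊢
    linarith
  · intro m n hmn y
    refine measure_mono_ae ?_
    filter_upwards [hD.mono] with ω hm h
    exact (hm (ha hmn)).trans h

lemma lintegral_map_inverse (hD : IsSubordinator D P) (hD0 : ∃ s, ¬ (∀ᵐ ω ∂P, D s ω = 0))
    (z : ℝ) {g : ℝ → ℝ≥0∞} (hg : Measurable g) :
    ∫⁻ x, g x ∂(P.map (inverseSubordinator D z)) = ∫⁻ ω, g (inverseSubordinator D z ω) ∂P :=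
  lintegral_map' hg.aemeasurable (hD.aemeasurable_inverse hD0 z)

lemma measurable_lintegral_inverse (hD : IsSubordinator D P)
    (hD0 : ∃ s, ¬ (∀ᵐ ω ∂P, D s ω = 0)) (t : ℝ) {g : ℝ → ℝ≥0∞} (hg : Measurable g) :
    Measurable fun y => ∫⁻ ω, g (inverseSubordinator D (t - y) ω) ∂P := by
  simp_rw [← hD.lintegral_map_inverse hD0 _ hg]
  exact (Measure.measurable_lintegral hg).comp (hD.measurable_map_inverse hD0 t)

/-- The occupation formula: functionals of the remaining time `Y(t) - u`, accumulated over
`u < Y(s)`, have as expectation an integral against the potential measure. -/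
lemma lintegral_lintegral_inverse_sub (hD : IsSubordinator D P)
    (hD0 : ∃ s, ¬ (∀ᵐ ω ∂P, D s ω = 0)) {s t : ℝ} (hst : s ≤ t) {g : ℝ → ℝ≥0∞}
    (hg : Measurable g) :
    ∫⁻ ω, (∫⁻ u in Set.Ioo (0 : ℝ) (inverseSubordinator D s ω),
        g (inverseSubordinator D t ω - u)) ∂P =
      ∫⁻ y in Set.Iic s, (∫⁻ ω, g (inverseSubordinator D (t - y) ω) ∂P)
        ∂(potentialMeasure D P) := by
  have hY := hD.aemeasurable_inverse hD0
  have hH := hD.measurable_lintegral_inverse hD0 t hg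
  let F : Ω → ℝ → ℝ≥0∞ := fun ω u =>
    (Set.Iio (inverseSubordinator D s ω)).indicator
      (fun u => g (inverseSubordinator D t ω - u)) u
  have hF : ∀ ω, ∫⁻ u in Set.Ioo (0 : ℝ) (inverseSubordinator D s ω),
      g (inverseSubordinator D t ω - u) = ∫⁻ u in Set.Ioi (0 : ℝ), F ω u := by
    intro ω
    rw [lintegral_indicator measurableSet_Iio, Measure.restrict_restrict measurableSet_Iio,
      Set.inter_comm, Set.Ioi_inter_Iio]
  have hFm : AEMeasurable (Function.uncurry F) (P.prod (volume.restrict (Set.Ioi (0 : ℝ)))) := by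
    have h1 : AEMeasurable (fun p : Ω × ℝ => g (inverseSubordinator D t p.1 - p.2))
        (P.prod (volume.restrict (Set.Ioi (0 : ℝ)))) :=
      hg.comp_aemeasurable ((hY t).comp_fst.sub measurable_snd.aemeasurable)
    have h2 : NullMeasurableSet {p : Ω × ℝ | p.2 < inverseSubordinator D s p.1}
        (P.prod (volume.restrict (Set.Ioi (0 : ℝ)))) :=
      nullMeasurableSet_lt measurable_snd.aemeasurable (hY s).comp_fst
    exact h1.indicator₀ h2
  simp_rw [hF]
  rw [lintegral_lintegral_swap hFm, ← lintegral_indicator measurableSet_Iic, potentialMeasure,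
    Measure.lintegral_bind hD.measurable_map_eval.aemeasurable
      (hH.indicator measurableSet_Iic).aemeasurable]
  refine lintegral_congr_ae ?_
  filter_upwards [ae_restrict_of_ae (hD.ae_measure_inverse_eq_zero hD0 s),
    ae_restrict_mem measurableSet_Ioi] with u hu hu0
  have hu0' : (0 : ℝ) ≤ u := le_of_lt hu0
  have h1 : ∫⁻ ω, F ω u ∂P =
      ∫⁻ ω in {ω | u < inverseSubordinator D s ω}, g (inverseSubordinator D t ω - u) ∂P := by
    rw [← lintegral_indicator₀ (nullMeasurableSet_lt aemeasurable_const (hY s))]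
    rfl
  rw [h1, ← setLIntegral_congr (hD.setOf_le_ae_eq hD0 hu0' hu),
    lintegral_indicator measurableSet_Iic]
  -- Integrate g against both sides of the Markov identity at time u.
  have h2 := congrArg (fun μ => ∫⁻ x, g x ∂μ) (hD.map_restrict_inverse_sub hD0 u.toNNReal hst)
  simp only [Real.coe_toNNReal _ hu0'] at h2
  rw [lintegral_map' hg.aemeasurable ((hY t).sub_const _).restrict,
    Measure.lintegral_bind (hD.measurable_map_inverse hD0 t).aemeasurable hg.aemeasurable] at h2
  simpa only [hD.lintegral_map_inverse hD0 _ hg] using h2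

end IsSubordinator

/-! ### Stieltjes functions and the power integral. -/

/-- The distribution function `x ↦ μ (-∞, x]` of a measure that is finite on left half-lines. -/
noncomputable def MeasureTheory.Measure.stieltjesOfIic (μ : Measure ℝ)
    (hμ : ∀ x, μ (Set.Iic x) ≠ ∞) : StieltjesFunction ℝ where
  toFun x := (μ (Set.Iic x)).toReal
  mono' x y hxy := ENNReal.toReal_mono (hμ y) (measure_mono (Set.Iic_subset_Iic.2 hxy))
  right_continuous' x := by
    rw [← continuousWithinAt_Ioi_iff_Ici]
    have h1 : ⋂ r > x, Set.Iic r = Set.Iic x := by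
      ext y
      simp only [gt_iff_lt, Set.mem_iInter, Set.mem_Iic]
      exact ⟨fun h => le_of_forall_gt_imp_ge_of_dense h, fun h r hr => h.trans hr.le⟩
    have h2 := tendsto_measure_biInter_gt (μ := μ) (s := Set.Iic) (a := x)
      (fun r _ => nullMeasurableSet_Iic) (fun i j _ hij => Set.Iic_subset_Iic.2 hij)
      ⟨x + 1, by simp, hμ _⟩
    rw [h1] at h2
    exact (ENNReal.tendsto_toReal (hμ x)).comp h2

lemma MeasureTheory.Measure.measure_stieltjesOfIic (μ : Measure ℝ)
    (hμ : ∀ x, μ (Set.Iic x) ≠ ∞) : (μ.stieltjesOfIic hμ).measure = μ := by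
  refine Measure.ext_of_Ioc _ _ fun a b hab => ?_
  rw [StieltjesFunction.measure_Ioc, ← Set.Iic_sdiff_Iic,
    measure_sdiff (Set.Iic_subset_Iic.2 hab.le) nullMeasurableSet_Iic (hμ a)]
  change ENNReal.ofReal ((μ (Set.Iic b)).toReal - (μ (Set.Iic a)).toReal) = _
  rw [ENNReal.ofReal_sub _ ENNReal.toReal_nonneg, ENNReal.ofReal_toReal (hμ a),
    ENNReal.ofReal_toReal (hμ b)]

/-- The case a = b is allowed: the singularity at u = b when κ < 1 is integrable because κ − 1 > −1.
-/
lemma lintegral_Ioo_rpow_sub {a b κ : ℝ} (ha : 0 ≤ a) (hab : a ≤ b) (hκ : 0 < κ) :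
    ∫⁻ u in Set.Ioo 0 a, ENNReal.ofReal ((b - u) ^ (κ - 1)) =
      ENNReal.ofReal ((b ^ κ - (b - a) ^ κ) / κ) := by
  have hκ' : -1 < κ - 1 := by linarith
  have h1 : IntervalIntegrable (fun u => (b - u) ^ (κ - 1)) volume 0 a := by
    have := (intervalIntegral.intervalIntegrable_rpow' hκ' (a := b) (b := b - a)).comp_sub_left b
    simpa using this
  have h2 : ∫ u in (0 : ℝ)..a, (b - u) ^ (κ - 1) = (b ^ κ - (b - a) ^ κ) / κ := by
    rw [intervalIntegral.integral_comp_sub_left (fun x => x ^ (κ - 1)), integral_rpow (.inl hκ')]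
    simp
  rw [← h2, intervalIntegral.integral_of_le ha, integral_Ioc_eq_integral_Ioo,
    ofReal_integral_eq_lintegral_ofReal]
  · exact ((intervalIntegrable_iff_integrableOn_Ioo_of_le ha).1 h1)
  · filter_upwards [ae_restrict_mem measurableSet_Ioo] with u hu
    exact Real.rpow_nonneg (by linarith [hu.2]) _

lemma inverseMoment_eq_toReal_lintegral {Ω : Type*} [MeasurableSpace Ω] {P : Measure Ω}
    {D : ℝ≥0 → Ω → ℝ} {γ z : ℝ} (h : AEMeasurable (inverseSubordinator D z) P) :
    inverseMoment D P γ z =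
      (∫⁻ ω, ENNReal.ofReal (inverseSubordinator D z ω ^ γ) ∂P).toReal :=
  integral_eq_lintegral_of_nonneg_ae
    (.of_forall fun _ => Real.rpow_nonneg inverseSubordinator_nonneg _)
    (h.pow_const γ).aestronglyMeasurable

/-! ### The moment formula for ordered times. -/

namespace IsSubordinator

variable {Ω : Type*} [MeasurableSpace Ω] {P : Measure Ω} [IsProbabilityMeasure P]
  {D : ℝ≥0 → Ω → ℝ} {s t κ : ℝ}

lemma integrable_inverse_sub_rpow (hD : IsSubordinator D P)
    (hD0 : ∃ s, ¬ (∀ᵐ ω ∂P, D s ω = 0)) (hst : s ≤ t) (hκ : 0 < κ) :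
    Integrable (fun ω => (inverseSubordinator D t ω - inverseSubordinator D s ω) ^ κ) P := by
  have hY := hD.aemeasurable_inverse hD0
  refine (hD.integrable_inverse_rpow hD0 t hκ).mono'
    (((hY t).sub (hY s)).pow_const κ).aestronglyMeasurable ?_
  filter_upwards [hD.ae_unbounded hD0] with ω hunb
  have h1 := inverseSubordinator_mono hunb hst
  have h2 : 0 ≤ inverseSubordinator D s ω := inverseSubordinator_nonneg
  simp only at h1
  rw [Real.norm_of_nonneg (Real.rpow_nonneg (by linarith) _)]
  exact Real.rpow_le_rpow (by linarith) (by linarith) hκ.le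

lemma lintegral_potentialMeasure_eq (hD : IsSubordinator D P)
    (hD0 : ∃ s, ¬ (∀ᵐ ω ∂P, D s ω = 0)) (hst : s ≤ t) (hκ : 0 < κ) :
    ∫⁻ y in Set.Iic s, (∫⁻ ω, ENNReal.ofReal (inverseSubordinator D (t - y) ω ^ (κ - 1)) ∂P)
        ∂(potentialMeasure D P) =
      ENNReal.ofReal ((inverseMoment D P κ t -
        ∫ ω, (inverseSubordinator D t ω - inverseSubordinator D s ω) ^ κ ∂P) / κ) := by
  have hi1 := hD.integrable_inverse_rpow hD0 t hκ
  have hi2 := hD.integrable_inverse_sub_rpow hD0 hst hκ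
  rw [← hD.lintegral_lintegral_inverse_sub hD0 hst
    (g := fun x => ENNReal.ofReal (x ^ (κ - 1))) (by fun_prop), inverseMoment,
    ← integral_sub hi1 hi2, ← integral_div, ofReal_integral_eq_lintegral_ofReal
      (f := fun ω => (inverseSubordinator D t ω ^ κ -
        (inverseSubordinator D t ω - inverseSubordinator D s ω) ^ κ) / κ)
      ((hi1.sub hi2).div_const κ)]
  · refine lintegral_congr_ae ?_
    filter_upwards [hD.ae_unbounded hD0] with ω hunb
    exact lintegral_Ioo_rpow_sub inverseSubordinator_nonneg (inverseSubordinator_mono hunb hst) hκ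
  · filter_upwards [hD.ae_unbounded hD0] with ω hunb
    have h1 := inverseSubordinator_mono hunb hst
    have h2 : 0 ≤ inverseSubordinator D s ω := inverseSubordinator_nonneg
    simp only at h1
    have := Real.rpow_le_rpow (sub_nonneg.2 h1)
      (sub_le_self (inverseSubordinator D t ω) h2) hκ.le
    exact div_nonneg (sub_nonneg.2 this) hκ.le

/-- The inverse is a.s. positive at the remaining level, for almost every position. -/
lemma ae_potentialMeasure_inverse_pos (hD : IsSubordinator D P)
    (hD0 : ∃ s, ¬ (∀ᵐ ω ∂P, D s ω = 0)) (hst : s ≤ t) :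
    ∀ᵐ y ∂((potentialMeasure D P).restrict (Set.Iic s)),
      ∀ᵐ ω ∂P, 0 < inverseSubordinator D (t - y) ω := by
  -- The occupation formula is tested on the indicator of (−∞, 0]: its left side vanishes since u <
  -- Y(s) ≤ Y(t). Positivity needs its own proof because `0 ^ (κ - 1) = 0` for κ < 1, so
  -- integrability alone would not exclude mass at 0.
  have hg : Measurable ((Set.Iic (0 : ℝ)).indicator (1 : ℝ → ℝ≥0∞)) :=
    measurable_one.indicator measurableSet_Iic
  have h := hD.lintegral_lintegral_inverse_sub hD0 hst hg
  have h0 : ∫⁻ ω, (∫⁻ u in Set.Ioo (0 : ℝ) (inverseSubordinator D s ω),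
      (Set.Iic (0 : ℝ)).indicator (1 : ℝ → ℝ≥0∞) (inverseSubordinator D t ω - u)) ∂P = 0 := by
    refine (lintegral_congr_ae ?_).trans lintegral_zero
    filter_upwards [hD.ae_unbounded hD0] with ω hunb
    have h1 := inverseSubordinator_mono hunb hst
    simp only at h1
    refine (setLIntegral_congr_fun measurableSet_Ioo fun u hu => ?_).trans lintegral_zero
    refine Set.indicator_of_notMem ?_ _
    simp only [Set.mem_Iic, not_le]
    linarith [hu.2]
  rw [h0, eq_comm, lintegral_eq_zero_iff (hD.measurable_lintegral_inverse hD0 t hg)] at h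
  filter_upwards [h] with y hy
  have hy' := (lintegral_eq_zero_iff'
    (hg.comp_aemeasurable (hD.aemeasurable_inverse hD0 (t - y)))).1 hy
  filter_upwards [hy'] with ω hω
  by_contra! hc
  simp [Set.indicator_of_mem (show inverseSubordinator D (t - y) ω ∈ Set.Iic 0 from hc)] at hω

lemma restrict_Icc_potentialMeasure (hD : IsSubordinator D P) (s : ℝ) :
    (potentialMeasure D P).restrict (Set.Icc 0 s) = (potentialMeasure D P).restrict (Set.Iic s) := by
  have h0 : ∀ᵐ y ∂(potentialMeasure D P), 0 ≤ y := by
    rw [ae_iff]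
    simp only [not_le]
    exact hD.potentialMeasure_Iio_zero
  refine Measure.restrict_congr_set ?_
  filter_upwards [h0] with y hy
  exact propext ⟨fun h => h.2, fun h => ⟨hy, h⟩⟩

lemma potentialMeasure_Iic_ne_top (hD : IsSubordinator D P)
    (hD0 : ∃ s, ¬ (∀ᵐ ω ∂P, D s ω = 0)) (x : ℝ) : potentialMeasure D P (Set.Iic x) ≠ ∞ := by
  rw [hD.potentialMeasure_Iic hD0]
  exact ENNReal.ofReal_ne_top

/-- The moment formula for ordered times, in terms of the potential measure. -/
lemma integral_inverse_sub_rpow (hD : IsSubordinator D P)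
    (hD0 : ∃ s, ¬ (∀ᵐ ω ∂P, D s ω = 0)) (hst : s ≤ t) (hκ : 0 < κ) :
    (∀ᵐ y ∂((potentialMeasure D P).restrict (Set.Iic s)),
      Integrable (fun ω => inverseSubordinator D (t - y) ω ^ (κ - 1)) P) ∧
    IntegrableOn (fun y => inverseMoment D P (κ - 1) (t - y)) (Set.Iic s)
      (potentialMeasure D P) ∧
    ∫ ω, (inverseSubordinator D t ω - inverseSubordinator D s ω) ^ κ ∂P =
      inverseMoment D P κ t -
        κ * ∫ y in Set.Iic s, inverseMoment D P (κ - 1) (t - y) ∂(potentialMeasure D P) := by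
  have hY := hD.aemeasurable_inverse hD0
  have hm := hD.measurable_lintegral_inverse hD0 t
    (g := fun x => ENNReal.ofReal (x ^ (κ - 1))) (by fun_prop)
  have hI := hD.lintegral_potentialMeasure_eq hD0 hst hκ
  have hne : ∫⁻ y in Set.Iic s,
      (∫⁻ ω, ENNReal.ofReal (inverseSubordinator D (t - y) ω ^ (κ - 1)) ∂P)
        ∂(potentialMeasure D P) ≠ ∞ := by
    rw [hI]
    exact ENNReal.ofReal_ne_top
  have hfin := ae_lt_top hm hne
  simp_rw [inverseMoment_eq_toReal_lintegral (γ := κ - 1) (hY _)]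
  refine ⟨?_, integrable_toReal_of_lintegral_ne_top hm.aemeasurable hne, ?_⟩
  · filter_upwards [hfin] with y hy
    refine ⟨((hY _).pow_const _).aestronglyMeasurable, ?_⟩
    rwa [hasFiniteIntegral_iff_ofReal
      (.of_forall fun _ => Real.rpow_nonneg inverseSubordinator_nonneg _)]
  · have hle : ∫ ω, (inverseSubordinator D t ω - inverseSubordinator D s ω) ^ κ ∂P ≤
        inverseMoment D P κ t := by
      refine integral_mono_ae (hD.integrable_inverse_sub_rpow hD0 hst hκ)
        (hD.integrable_inverse_rpow hD0 t hκ) ?_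
      filter_upwards [hD.ae_unbounded hD0] with ω hunb
      exact Real.rpow_le_rpow (sub_nonneg.2 (inverseSubordinator_mono hunb hst))
        (sub_le_self _ inverseSubordinator_nonneg) hκ.le
    rw [integral_toReal hm.aemeasurable hfin, hI,
      ENNReal.toReal_ofReal (div_nonneg (sub_nonneg.2 hle) hκ.le)]
    field_simp
    ring

end IsSubordinator

/-- For a subordinator `D` that is not almost surely zero: its inverse `Y` is finite and integrable,
`U(x) = E[Y(x)]` (extended by `0` to `x < 0`) is a Stieltjes function, and the moment formula for
the increments of `Y` holds, with all the expectations and integrals in it finite. The possible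
atom of `dU` at `0`, of mass `U(0)`, belongs to the integral. -/
theorem lemma2p1 {Ω : Type*} [MeasurableSpace Ω] (P : Measure Ω) [IsProbabilityMeasure P]
    (D : ℝ≥0 → Ω → ℝ) (hD : IsSubordinator D P) (hD0 : ∃ s, ¬ (∀ᵐ ω ∂P, D s ω = 0)) :
    (∀ᵐ ω ∂P, ∀ x : ℝ, ∃ s, x < D s ω) ∧
    (∀ x : ℝ, 0 ≤ x → Integrable (inverseSubordinator D x) P) ∧
    ∃ U : StieltjesFunction ℝ,
      (∀ x : ℝ, 0 ≤ x → U x = ∫ ω, inverseSubordinator D x ω ∂P) ∧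
      (∀ x : ℝ, x < 0 → U x = 0) ∧
      ∀ s t κ : ℝ, 0 < s → 0 < t → 0 < κ →
        Integrable (fun ω => |inverseSubordinator D t ω - inverseSubordinator D s ω| ^ κ) P ∧
        Integrable (fun ω => inverseSubordinator D (max t s) ω ^ κ) P ∧
        (∀ᵐ y ∂(U.measure.restrict (Set.Icc 0 (min t s))),
          (∀ᵐ ω ∂P, 0 < inverseSubordinator D (max t s - y) ω) ∧
          Integrable (fun ω => inverseSubordinator D (max t s - y) ω ^ (κ - 1)) P) ∧
        IntegrableOn (fun y => inverseMoment D P (κ - 1) (max t s - y))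
          (Set.Icc 0 (min t s)) U.measure ∧
        ∫ ω, |inverseSubordinator D t ω - inverseSubordinator D s ω| ^ κ ∂P
          = inverseMoment D P κ (max t s)
            - κ * ∫ y in Set.Icc 0 (min t s),
                inverseMoment D P (κ - 1) (max t s - y) ∂U.measure := by

  have hfin := hD.potentialMeasure_Iic_ne_top hD0
  refine ⟨hD.ae_unbounded hD0, fun x _ => hD.integrable_inverse hD0 x,
    (potentialMeasure D P).stieltjesOfIic hfin, fun x _ => ?_, fun x hx => ?_, ?_⟩
  · change (potentialMeasure D P (Set.Iic x)).toReal = _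
    rw [hD.potentialMeasure_Iic hD0,
      ENNReal.toReal_ofReal (integral_nonneg fun _ => inverseSubordinator_nonneg)]
  · change (potentialMeasure D P (Set.Iic x)).toReal = _
    rw [measure_mono_null (Set.Iic_subset_Iio.2 hx) hD.potentialMeasure_Iio_zero,
      ENNReal.toReal_zero]
  intro s t κ _ _ hκ
  rw [Measure.measure_stieltjesOfIic, IntegrableOn, hD.restrict_Icc_potentialMeasure]
  wlog hst : s ≤ t generalizing s t
  · have := this t s ‹_› ‹_› (le_of_not_ge hst)
    simpa only [max_comm s t, min_comm s t,
      abs_sub_comm (inverseSubordinator D s _) (inverseSubordinator D t _)] using this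
  rw [max_eq_left hst, min_eq_right hst]
  have habs : (fun ω => |inverseSubordinator D t ω - inverseSubordinator D s ω| ^ κ) =ᵐ[P]
      fun ω => (inverseSubordinator D t ω - inverseSubordinator D s ω) ^ κ := by
    filter_upwards [hD.ae_unbounded hD0] with ω hunb
    rw [abs_of_nonneg (sub_nonneg.2 (inverseSubordinator_mono hunb hst))]
  obtain ⟨h1, h2, h3⟩ := hD.integral_inverse_sub_rpow hD0 hst hκ
  exact ⟨(hD.integrable_inverse_sub_rpow hD0 hst hκ).congr habs.symm,
    hD.integrable_inverse_rpow hD0 t hκ,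
    (hD.ae_potentialMeasure_inverse_pos hD0 hst).and h1, h2, (integral_congr_ae habs).trans h3⟩
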